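/- Let $\Gamma$ be a non-empty finite simplicial graph (no loops, no multiple edges) with vertex set $V(\Gamma)=\{a_1,\dots,a_s\}$, and let $\triangle_\Gamma$ be its flag complex, i.e. the finite simplicial complex whose simplices are the non-empty sets of pairwise adjacent vertices of $\Gamma$. Let $$G_\Gamma=\langle a_1,\dots,a_s \mid a_ia_ja_i^{-1}a_j^{-1} \text{ for each edge } (a_i,a_j) \text{ of } \Gamma\rangle$$ be the right-angled Artin group of $\Gamma$, let $\varphi\colon G_\Gamma\to\mathbb Z$ be the epimorphism with $\varphi(a_i)=1$ for all $i$, and let $H_\Gamma=\ker\varphi$ be the Bestvina–Brady group. For $m\in\mathbb Z$ and $1\le i\le s$ let $x_{m,i}$ be a symbol, standing for the element $a_1^m a_i a_1^{-m-1}$ of $H_\Gamma$. The Reidemeister rewriting process $\tau$ sends a word $u=a_{i_1}^{\epsilon_1}\cdots a_{i_r}^{\epsilon_r}$ ($\epsilon_l=\pm1$) representing an element of $H_\Gamma$ to $$\tau(u)=x_{k_1,i_1}^{\epsilon_1}\cdots x_{k_r,i_r}^{\epsilon_r},$$ where $k_l=\epsilon_1+\dots+\epsilon_{l-1}$ if $\epsilon_l=1$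 and $k_l=\epsilon_1+\dots+\epsilon_l$ if $\epsilon_l=-1$. For adjacent $a_i,a_j$ let $e_{i,j}$ be the word $a_ia_j^{-1}$, so that $e_{i,j}^{-1}$ is the word $a_ja_i^{-1}$. If $\triangle_\Gamma$ is simply connected, then for every directed $3$-cycle $(a_{i_1},a_{i_2},a_{i_3})$ of $\Gamma$ and $q=\pm1$ the word $\tau(e_{i_1,i_2}^{q}e_{i_2,i_3}^{q}e_{i_3,i_1}^{q})$ involves only the symbols $x_{0,i}$, and $H_\Gamma$ has the finite presentation $$H_\Gamma=\bigl\langle x_{0,1},\dots,x_{0,s} \,\bigm|\, x_{0,1},\ \ \tau(e_{i_1,i_2}^{q}e_{i_2,i_3}^{q}e_{i_3,i_1}^{q}) \text{ for all directed } 3\text{-cycles } (a_{i_1},a_{i_2},a_{i_3}) \text{ of } \Gamma \text{ and } q=\pm1\bigr\rangle,$$ where the generator $x_{0,i}$ corresponds to the element $a_ia_1^{-1}$ of $H_\Gamma$. -/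

import Mathlib

namespace BestvinaBrady

/-- The flag complex of a finite simplicial graph `G`, as a topological space: its geometric
realization in barycentric coordinates. A point is a family of non-negative weights on the vertices
with sum `1` whose support is a complete subgraph. As `V` is finite, the subspace topology from
`V → ℝ` is the usual topology of the finite simplicial complex. -/
def flagComplex {V : Type*} [Fintype V] (G : SimpleGraph V) : Set (V → ℝ) :=
  {x | x ∈ stdSimplex ℝ V ∧ G.IsClique (Function.support x)}

/-- The defining relators of the right-angled Artin group: the commutators of adjacent vertices. -/
def raagRels {V : Type*} (G : SimpleGraph V) : Set (FreeGroup V) :=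
  {r | ∃ i j : V, G.Adj i j ∧
    r = FreeGroup.of i * FreeGroup.of j * (FreeGroup.of i)⁻¹ * (FreeGroup.of j)⁻¹}

/-- The right-angled Artin group of `G`. -/
abbrev RAAG {V : Type*} (G : SimpleGraph V) : Type _ :=
  PresentedGroup (raagRels G)

/-- The standard generator of the right-angled Artin group given by the vertex `i`. -/
def gen {V : Type*} (G : SimpleGraph V) (i : V) : RAAG G :=
  PresentedGroup.of i

theorem raagRels_degree {V : Type*} (G : SimpleGraph V) :
    ∀ r ∈ raagRels G,
      FreeGroup.lift (fun _ : V => Multiplicative.ofAdd (1 : ℤ)) r = 1 := by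
  rintro r ⟨i, j, -, rfl⟩
  simp

/-- The canonical epimorphism onto `ℤ`, sending every standard generator to `1`. -/
def canonicalEpi {V : Type*} (G : SimpleGraph V) : RAAG G →* Multiplicative ℤ :=
  PresentedGroup.toGroup (raagRels_degree G)

/-- The Bestvina-Brady group: the kernel of the canonical epimorphism. -/
def bbGroup {V : Type*} (G : SimpleGraph V) : Subgroup (RAAG G) :=
  (canonicalEpi G).ker

/-- Words in the letters `a_i` and `a_i⁻¹`: the letter `(i, true)` is `a_i`, the letter `(i, false)`
is `a_i⁻¹`. -/
abbrev Word (V : Type*) : Type _ := List (V × Bool)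

/-- The `q`-th power of a word, for an integer `q`; a negative power is a power of the formal
inverse word. -/
def wordPow {V : Type*} (u : Word V) : ℤ → Word V
  | Int.ofNat n => (List.replicate n u).flatten
  | Int.negSucc n => (List.replicate (n + 1) (FreeGroup.invRev u)).flatten

/-- The word `e_{i,j} = a_i a_j⁻¹` of the directed edge from `i` to `j`. -/
def edgeWord {V : Type*} (i j : V) : Word V := [(i, true), (j, false)]

/-- The Reidemeister rewriting process for the kernel of the canonical epimorphism, with the coset
representatives `w_m = a_1 ^ m`, started after a prefix of degree `m`. The result is a word in
symbols `x_{m,i}`, here the free generators indexed by `(m, i) : ℤ × V`, and `x_{m,i}` stands for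
the element `w_m a_i w_{m+1}⁻¹` of the kernel. A letter `a_i` read after a prefix of degree `m` is
replaced by `x_{m,i}`, a letter `a_i⁻¹` read after a prefix of degree `m` by `x_{m-1,i}⁻¹`. -/
def rewriteFrom {V : Type*} : ℤ → Word V → FreeGroup (ℤ × V)
  | _, [] => 1
  | m, (i, true) :: u => FreeGroup.of (m, i) * rewriteFrom (m + 1) u
  | m, (i, false) :: u => (FreeGroup.of (m - 1, i))⁻¹ * rewriteFrom (m - 1) u

/-- The Reidemeister rewriting process `τ`. -/
def tau {V : Type*} (u : Word V) : FreeGroup (ℤ × V) := rewriteFrom 0 u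

/-- The rewritten words `τ(e_{i,j}^q e_{j,k}^q e_{k,i}^q)`, for the directed 3-cycles `(i, j, k)` of
`G` and `q = ±1`. -/
def tauTriangles {V : Type*} (G : SimpleGraph V) : Set (FreeGroup (ℤ × V)) :=
  {t | ∃ i j k : V, G.Adj i j ∧ G.Adj j k ∧ G.Adj k i ∧ ∃ q : ℤ, (q = 1 ∨ q = -1) ∧
    t = tau (wordPow (edgeWord i j) q ++ wordPow (edgeWord j k) q ++ wordPow (edgeWord k i) q)}

/-- The inclusion of the free group on the symbols `x_{0,i}`, indexed by `i : V`, into the free group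
on all symbols `x_{m,i}`. -/
def inclZero (V : Type*) : FreeGroup V →* FreeGroup (ℤ × V) :=
  FreeGroup.map (fun i => ((0 : ℤ), i))

/-- The relators of the presentation, as elements of the free group on the symbols `x_{0,i}`: the
rewritten words of the directed 3-cycles, and the generator `x_{0,1} = a_1 a_1⁻¹` of the base
vertex. -/
def bbRels {V : Type*} (G : SimpleGraph V) (a₁ : V) : Set (FreeGroup V) :=
  inclZero V ⁻¹' tauTriangles G ∪ {FreeGroup.of a₁}

end BestvinaBrady

/-!
Write `x_i` for the generators of the presented group `P` and `e_{i,j} = x_i x_j⁻¹`. The rewritten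
triangle word with `q = 1` is trivial in the free group, and the one with `q = -1` says that the
elements `e_{i,j}` and `e_{j,k}` of a triangle commute (`commute_edgeElt`). As
`e_{i,j} e_{j,k} = e_{i,k}`, it follows that for every integer `n` the powers `e_{i,j} ^ n` form a
`P`-valued `1`-cocycle on the flag complex.

The flag complex is covered by the open stars of its vertices, whose intersection pattern is that of
the cliques. A cocycle on cliques is therefore the transition data of a covering space with fibre
`P`; by simple connectedness the covering has a section, so the cocycle is a coboundary
(`exists_cobounding`). This gives elements `y n i` of `P` with `y n i = e_{i,j} ^ n * y n j` for
adjacent `i`, `j` and `y n a₁ = 1` (`exists_powers`): they behave like `a_i ^ n * a_1 ^ (-n)`.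

With these elements one can write down on `P × ℤ` the right multiplication by `a_i` of the Artin
group, as if `(p, m)` were `p * a_1 ^ m` (`genPerm`). The permutations of adjacent vertices commute,
so the Artin group acts on `P × ℤ` (`rightAction`). The homomorphism `toRAAG` with
`x_i ↦ a_i a_1⁻¹` is injective because the action recovers `p` from `toRAAG p`
(`toRAAG_injective`), and its image is the whole kernel because `(p, m) ↦ toRAAG p * a_1 ^ m` is
equivariant (`exists_toRAAG_eq`).
-/

namespace BestvinaBrady

open Topology

/-! ### Locally constant cocycles on simply connected spaces -/

/-- A constant-coefficient Čech `1`-cocycle with values in a discrete group, on an open cover of a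
simply connected, locally path connected space, is a coboundary. The cocycle is the transition data
of a covering space with fibre `P`; simple connectedness gives it a global section, and `f i` is
that section read in the trivialization over `U i`. -/
theorem exists_continuousOn_cobounding {X ι P : Type*} [TopologicalSpace X]
    [SimplyConnectedSpace X] [LocallyPathConnectedSpace X] [Group P] [TopologicalSpace P]
    [DiscreteTopology P] (U : ι → Set X) (hU : ∀ i, IsOpen (U i)) (hcov : ∀ x, ∃ i, x ∈ U i)
    (c : ι → ι → P)
    (hc : ∀ i j k x, x ∈ U i → x ∈ U j → x ∈ U k → c i j * c j k = c i k) :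
    ∃ f : ι → X → P, (∀ i, ContinuousOn (f i) (U i)) ∧
      ∀ i j x, x ∈ U i → x ∈ U j → f i x = c i j * f j x := by
  choose idx hidx using hcov
  let Z : FiberBundleCore ι X P :=
    { baseSet := U
      isOpen_baseSet := hU
      indexAt := idx
      mem_baseSet_at := hidx
      coordChange := fun i j _ v => c j i * v
      coordChange_self := fun i x hx v => by
        have h := hc i i i x hx hx hx
        rw [mul_eq_left] at h
        rw [h, one_mul]
      continuousOn_coordChange := fun i j => by
        have h : Continuous fun p : X × P => c j i * p.2 :=
          continuous_of_discreteTopology.comp continuous_snd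
        exact h.continuousOn
      coordChange_comp := fun i j k x hx v => by
        rw [← mul_assoc, hc k j i x hx.2 hx.1.2 hx.1.1] }
  have cov : IsCoveringMap Z.proj := FiberBundle.isCoveringMap
  obtain ⟨x₀⟩ : Nonempty X := inferInstance
  obtain ⟨s, ⟨-, hs⟩, -⟩ := cov.existsUnique_continuousMap_lifts (ContinuousMap.id X) x₀
    (⟨x₀, (1 : P)⟩ : Z.TotalSpace) rfl
  have hs' : ∀ x, (s x).1 = x := fun x => congrFun hs x
  refine ⟨fun i x => (Z.localTriv i (s x)).2, fun i => ?_, fun i j x hi hj => ?_⟩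
  · refine continuous_snd.comp_continuousOn
      ((Z.localTriv i).continuousOn.comp s.continuous.continuousOn fun x hx => ?_)
    rw [Z.mem_localTriv_source]
    change (s x).1 ∈ U i
    rwa [hs']
  · simp only [Z.localTriv_apply]
    have h : c i j * c j (idx (s x).1) = c i (idx (s x).1) :=
      hc i j _ x hi hj (by rw [hs']; exact hidx x)
    have hv : ∀ v : P, c i (idx (s x).1) * v = c i j * (c j (idx (s x).1) * v) := fun v => by
      rw [← mul_assoc, h]
    exact hv (s x).2

/-! ### The topology of the flag complex -/

section FlagComplex

variable {V : Type*} [Fintype V] {G : SimpleGraph V}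

theorem segment_subset_flagComplex {x y : V → ℝ} (hx : x ∈ flagComplex G)
    (hy : y ∈ flagComplex G) (hxy : Function.support x ⊆ Function.support y) :
    segment ℝ x y ⊆ {z | z ∈ flagComplex G ∧ Function.support x ⊆ Function.support z} := by
  rintro z ⟨a, b, ha, hb, hab, rfl⟩
  refine ⟨⟨convex_stdSimplex ℝ V hx.1 hy.1 ha hb hab, hy.2.subset fun k hk => ?_⟩, fun k hk => ?_⟩
  · by_contra hyk
    have hxk : k ∉ Function.support x := fun h => hyk (hxy h)
    simp only [Function.mem_support, not_not] at hyk hxk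
    simp [hyk, hxk] at hk
  · have hxk : 0 < x k := lt_of_le_of_ne (hx.1.1 k) (Ne.symm hk)
    have hyk : 0 < y k := lt_of_le_of_ne (hy.1.1 k) (Ne.symm (hxy hk))
    have : 0 < a * x k + b * y k := by
      rcases ha.eq_or_lt with rfl | ha
      · obtain rfl : b = 1 := by linarith
        simpa using hyk
      · have := mul_pos ha hxk
        have := mul_nonneg hb hyk.le
        linarith
    exact this.ne'

/-- The points near `x` whose support contains that of `x` form a star-shaped neighbourhood. -/
instance locallyPathConnectedSpace_flagComplex (G : SimpleGraph V) :
    LocallyPathConnectedSpace (flagComplex G) where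
  path_connected_basis x := by
    rw [Filter.hasBasis_self]
    intro t ht
    obtain ⟨ε, hε, hεt⟩ := Metric.mem_nhds_iff.1 ht
    refine ⟨{y | dist y x < ε ∧ ∀ k, x.1 k ≠ 0 → y.1 k ≠ 0}, ?_, ?_, fun y hy => hεt hy.1⟩
    · refine Filter.inter_mem (Metric.ball_mem_nhds x hε) (Filter.eventually_all.2 fun k => ?_)
      by_cases hk : x.1 k = 0
      · simp [hk]
      · have hcont : Continuous fun y : flagComplex G => y.1 k :=
          (continuous_apply k).comp continuous_subtype_val
        filter_upwards [hcont.continuousAt.eventually_ne hk] with y hy _ using hy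
    · rw [IsInducing.subtypeVal.isPathConnected_iff]
      refine StarConvex.isPathConnected (a := x.1) ?_ ⟨x, ⟨by simpa using hε, fun _ => id⟩, rfl⟩
      rw [starConvex_iff_segment_subset]
      rintro _ ⟨y, ⟨hyε, hy⟩, rfl⟩ z hz
      have hz' := segment_subset_flagComplex x.2 y.2 hy hz
      refine ⟨⟨z, hz'.1⟩, ⟨?_, hz'.2⟩, rfl⟩
      exact (convex_ball x.1 ε).segment_subset (Metric.mem_ball_self hε) hyε hz

/-- The vertex `i` of the flag complex. -/
noncomputable def flagVertex (G : SimpleGraph V) (i : V) : flagComplex G :=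
  let _ := Classical.decEq V
  ⟨Pi.single i 1, single_mem_stdSimplex ℝ i, fun a ha b hb hab => by
    have h : ∀ k, k ∈ Function.support (Pi.single i (1 : ℝ) : V → ℝ) → k = i := fun k hk => by
      by_contra hne
      exact hk (Pi.single_eq_of_ne hne 1)
    exact absurd ((h a ha).trans (h b hb).symm) hab⟩

theorem flagVertex_apply_ne_zero_iff {i k : V} : (flagVertex G i).1 k ≠ 0 ↔ k = i := by
  classical
  by_cases h : k = i <;> simp [flagVertex, h]

/-- The open star of the vertex `i` in the flag complex. -/
def openStar (G : SimpleGraph V) (i : V) : Set (flagComplex G) :=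
  {x | x.1 i ≠ 0}

theorem isOpen_openStar (i : V) : IsOpen (openStar G i) := by
  have hcont : Continuous fun y : flagComplex G => y.1 i :=
    (continuous_apply i).comp continuous_subtype_val
  exact isOpen_ne.preimage hcont

theorem exists_mem_openStar (x : flagComplex G) : ∃ i, x ∈ openStar G i := by
  by_contra! h
  have h0 : ∀ i, x.1 i = 0 := fun i => not_not.1 (h i)
  have h1 := x.2.1.2
  simp [h0] at h1

theorem flagVertex_mem_openStar (i : V) : flagVertex G i ∈ openStar G i :=
  flagVertex_apply_ne_zero_iff.2 rfl

/-- The open star of `i` is star-shaped about `i`, so each of its points is joined to `i` in it. -/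
theorem apply_flagVertex_eq {P : Type*} [TopologicalSpace P] [DiscreteTopology P] {i : V}
    {f : flagComplex G → P} (hf : ContinuousOn f (openStar G i)) {x : flagComplex G}
    (hx : x ∈ openStar G i) : f (flagVertex G i) = f x := by
  have hsub : Function.support (flagVertex G i).1 ⊆ Function.support x.1 := fun k hk => by
    obtain rfl := flagVertex_apply_ne_zero_iff.1 hk
    exact hx
  have hseg := segment_subset_flagComplex (flagVertex G i).2 x.2 hsub
  have hpre : IsPreconnected
      ((↑) ⁻¹' segment ℝ (flagVertex G i).1 x.1 : Set (flagComplex G)) := by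
    rw [← IsInducing.subtypeVal.isPreconnected_image, Subtype.image_preimage_coe,
      Set.inter_eq_right.2 fun z hz => (hseg hz).1]
    exact (convex_segment _ _).isPreconnected
  refine hpre.constant (hf.mono fun z hz => (hseg hz).2 (flagVertex_mem_openStar i))
    (left_mem_segment ℝ _ _) (right_mem_segment ℝ _ _)

/-- The midpoint of an edge lies in the open stars of both ends. -/
theorem exists_mem_openStar_of_adj {i j : V} (h : G.Adj i j) :
    ∃ x, x ∈ openStar G i ∧ x ∈ openStar G j := by
  have hi := fun k => flagVertex_apply_ne_zero_iff (G := G) (i := i) (k := k)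
  have hj := fun k => flagVertex_apply_ne_zero_iff (G := G) (i := j) (k := k)
  let z : V → ℝ := (2⁻¹ : ℝ) • (flagVertex G i).1 + (2⁻¹ : ℝ) • (flagVertex G j).1
  have hpos : ∀ k, z k ≠ 0 ↔ k = i ∨ k = j := fun k => by
    have h1 := (flagVertex G i).2.1.1 k
    have h2 := (flagVertex G j).2.1.1 k
    rw [← hi, ← hj, ← not_and_or, not_iff_not]
    simp only [z, Pi.add_apply, Pi.smul_apply, smul_eq_mul]
    constructor
    · intro h; constructor <;> linarith
    · rintro ⟨h, h'⟩; simp [h, h']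
  refine ⟨⟨z, convex_stdSimplex ℝ V (flagVertex G i).2.1 (flagVertex G j).2.1 (by norm_num)
    (by norm_num) (by norm_num), fun a ha b hb hab => ?_⟩, (hpos i).2 (.inl rfl),
    (hpos j).2 (.inr rfl)⟩
  rcases (hpos a).1 ha with rfl | rfl <;> rcases (hpos b).1 hb with rfl | rfl
  exacts [absurd rfl hab, h, h.symm, absurd rfl hab]

/-- On a simply connected flag complex every `1`-cocycle with values in a group, written as labels
`c i j` of the directed edges that compose along simplices, is a coboundary. -/
theorem exists_cobounding [SimplyConnectedSpace (flagComplex G)] {P : Type*} [Group P]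
    (c : V → V → P)
    (hc : ∀ i j k, G.IsClique {i, j, k} → c i j * c j k = c i k) :
    ∃ y : V → P, ∀ i j, G.Adj i j → y i = c i j * y j := by
  let _ : TopologicalSpace P := ⊥
  have _ : DiscreteTopology P := ⟨rfl⟩
  obtain ⟨f, hf, hfc⟩ := exists_continuousOn_cobounding (openStar G) isOpen_openStar
    exists_mem_openStar c fun i j k x hi hj hk => hc i j k <| x.2.2.subset <| by
      rintro a (rfl | rfl | rfl)
      exacts [hi, hj, hk]
  refine ⟨fun i => f i (flagVertex G i), fun i j hij => ?_⟩
  obtain ⟨x, hxi, hxj⟩ := exists_mem_openStar_of_adj hij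
  simp only [apply_flagVertex_eq (hf i) hxi, apply_flagVertex_eq (hf j) hxj, hfc i j x hxi hxj]

/-- A connected flag complex has a connected graph: a function on the vertices that takes equal
values at adjacent vertices is constant. -/
theorem eq_of_forall_adj_eq [PreconnectedSpace (flagComplex G)] {P : Type*} {h : V → P}
    (hadj : ∀ i j, G.Adj i j → h i = h j) (i j : V) : h i = h j := by
  choose idx hidx using exists_mem_openStar (G := G)
  have hval : ∀ k x, x ∈ openStar G k → h (idx x) = h k := fun k x hx => by
    by_cases hk : idx x = k
    · rw [hk]
    · exact hadj _ _ (x.2.2 (hidx x) hx hk)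
  have hconst : IsLocallyConstant fun x => h (idx x) := by
    rw [IsLocallyConstant.iff_eventually_eq]
    intro x
    filter_upwards [(isOpen_openStar (idx x)).mem_nhds (hidx x)] with y hy using hval _ y hy
  rw [← hval i _ (flagVertex_mem_openStar i), ← hval j _ (flagVertex_mem_openStar j)]
  exact hconst.apply_eq_of_preconnectedSpace _ _

end FlagComplex

/-! ### The rewritten triangle words -/

section TriangleWords

variable {V : Type*}

theorem tau_triangle_one (i j k : V) :
    tau (wordPow (edgeWord i j) 1 ++ wordPow (edgeWord j k) 1 ++ wordPow (edgeWord k i) 1) =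
      inclZero V 1 := by
  have h : ∀ u : Word V, wordPow u 1 = u := fun u => by
    change (List.replicate 1 u).flatten = u
    simp
  simp [h, edgeWord, tau, rewriteFrom]

theorem tau_triangle_neg_one (i j k : V) :
    tau (wordPow (edgeWord i j) (-1) ++ wordPow (edgeWord j k) (-1) ++
        wordPow (edgeWord k i) (-1)) =
      inclZero V ((FreeGroup.of i * (FreeGroup.of j)⁻¹)⁻¹ * (FreeGroup.of j * (FreeGroup.of k)⁻¹)⁻¹ *
        (FreeGroup.of k * (FreeGroup.of i)⁻¹)⁻¹) := by
  have h : ∀ u : Word V, wordPow u (-1) = FreeGroup.invRev u := fun u => by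
    change (List.replicate (0 + 1) (FreeGroup.invRev u)).flatten = _
    simp
  simp [h, edgeWord, tau, rewriteFrom, inclZero, FreeGroup.invRev, mul_assoc]

theorem inclZero_injective : Function.Injective (inclZero V) :=
  FreeGroup.map_injective (Prod.mk_right_injective 0)

variable (G : SimpleGraph V)

theorem tauTriangles_subset_range : tauTriangles G ⊆ Set.range (inclZero V) := by
  rintro _ ⟨i, j, k, -, -, -, q, rfl | rfl, rfl⟩
  exacts [⟨_, (tau_triangle_one i j k).symm⟩, ⟨_, (tau_triangle_neg_one i j k).symm⟩]

theorem finite_tauTriangles [Finite V] : (tauTriangles G).Finite := by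
  let w (q : ℤ) (p : V × V × V) : FreeGroup (ℤ × V) :=
    tau (wordPow (edgeWord p.1 p.2.1) q ++ wordPow (edgeWord p.2.1 p.2.2) q ++
      wordPow (edgeWord p.2.2 p.1) q)
  refine ((Set.finite_range (w 1)).union (Set.finite_range (w (-1)))).subset ?_
  rintro _ ⟨i, j, k, -, -, -, q, rfl | rfl, rfl⟩
  exacts [.inl ⟨(i, j, k), rfl⟩, .inr ⟨(i, j, k), rfl⟩]

theorem finite_bbRels [Finite V] (a₁ : V) : (bbRels G a₁).Finite :=
  ((finite_tauTriangles G).preimage inclZero_injective.injOn).union (Set.finite_singleton _)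

/-- The words with `q = 1` are trivial, so only those with `q = -1` have to be checked. -/
theorem lift_eq_one_of_mem_bbRels {a₁ : V} {H : Type*} [Group H] {g : V → H} (h₁ : g a₁ = 1)
    (h : ∀ i j k, G.Adj i j → G.Adj j k → G.Adj k i →
      (g i * (g j)⁻¹)⁻¹ * (g j * (g k)⁻¹)⁻¹ * (g k * (g i)⁻¹)⁻¹ = 1) :
    ∀ r ∈ bbRels G a₁, FreeGroup.lift g r = 1 := by
  rintro r (⟨i, j, k, hij, hjk, hki, q, rfl | rfl, hr⟩ | rfl)
  · rw [tau_triangle_one] at hr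
    simp [inclZero_injective hr]
  · rw [tau_triangle_neg_one] at hr
    simpa [inclZero_injective hr] using h i j k hij hjk hki
  · simpa using h₁

end TriangleWords

/-! ### Edge elements -/

section EdgeElements

variable {V : Type*} (G : SimpleGraph V) (a₁ : V)

/-- The group given by the finite presentation. -/
abbrev TriangleGroup : Type _ := PresentedGroup (bbRels G a₁)

/-- The element of the presented group carried by the directed edge from `i` to `j`; it stands for
`a_i a_j⁻¹`. -/
def edgeElt (i j : V) : TriangleGroup G a₁ :=
  PresentedGroup.of i * (PresentedGroup.of j)⁻¹

theorem of_base_eq_one : (PresentedGroup.of a₁ : TriangleGroup G a₁) = 1 :=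
  PresentedGroup.one_of_mem (.inr rfl)

variable {G a₁}

theorem edgeElt_mul_edgeElt (i j k : V) :
    edgeElt G a₁ i j * edgeElt G a₁ j k = edgeElt G a₁ i k := by
  simp [edgeElt, mul_assoc]

theorem edgeElt_self (i : V) : edgeElt G a₁ i i = 1 := by
  simp [edgeElt]

/-- The relator of a triangle says that its edge elements commute. -/
theorem commute_edgeElt {i j k : V} (h : G.IsClique {i, j, k}) :
    Commute (edgeElt G a₁ i j) (edgeElt G a₁ j k) := by
  by_cases hij : i = j
  · simp [hij, edgeElt_self]
  by_cases hjk : j = k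
  · simp [hjk, edgeElt_self]
  by_cases hki : k = i
  · subst hki
    rw [eq_inv_of_mul_eq_one_left
      ((edgeElt_mul_edgeElt (G := G) (a₁ := a₁) k j k).trans (edgeElt_self k))]
    exact (Commute.refl _).inv_left
  have hr : (PresentedGroup.mk (bbRels G a₁)) _ = 1 := PresentedGroup.one_of_mem
    (.inl ⟨i, j, k, h (by simp) (by simp) hij, h (by simp) (by simp) hjk,
      h (by simp) (by simp) hki, -1, .inr rfl, (tau_triangle_neg_one i j k).symm⟩)
  simp only [map_mul, map_inv] at hr
  change (edgeElt G a₁ i j)⁻¹ * (edgeElt G a₁ j k)⁻¹ * (edgeElt G a₁ k i)⁻¹ = 1 at hr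
  have hki' : (edgeElt G a₁ k i)⁻¹ = edgeElt G a₁ i j * edgeElt G a₁ j k := by
    rw [edgeElt_mul_edgeElt]
    simp [edgeElt]
  rw [hki', ← mul_inv_rev, inv_mul_eq_one] at hr
  exact hr.symm

theorem edgeElt_zpow_mul {i j k : V} (h : G.IsClique {i, j, k}) (n : ℤ) :
    edgeElt G a₁ i j ^ n * edgeElt G a₁ j k ^ n = edgeElt G a₁ i k ^ n := by
  rw [← (commute_edgeElt h).mul_zpow, edgeElt_mul_edgeElt]

/-- Elements `y n i` of the presented group that play the role of `a_i ^ n * a_1 ^ (-n)`. This is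
the step that uses simple connectedness: the `n`-th powers of the edge elements form a cocycle.
A solution is unique once it is normalized at `a₁`, so it is known for `n = 0` and `n = 1`. -/
theorem exists_powers [Fintype V] [SimplyConnectedSpace (flagComplex G)] :
    ∃ y : ℤ → V → TriangleGroup G a₁,
      (∀ n i j, G.Adj i j → y n i = edgeElt G a₁ i j ^ n * y n j) ∧
      (∀ n, y n a₁ = 1) ∧ (∀ i, y 0 i = 1) ∧ ∀ i, y 1 i = PresentedGroup.of i := by
  choose z hz using fun n : ℤ => exists_cobounding (G := G)
    (fun i j => edgeElt G a₁ i j ^ n) fun i j k h => edgeElt_zpow_mul h n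
  have hy : ∀ n i j, G.Adj i j →
      z n i * (z n a₁)⁻¹ = edgeElt G a₁ i j ^ n * (z n j * (z n a₁)⁻¹) := fun n i j hij => by
    rw [hz n i j hij, mul_assoc]
  refine ⟨fun n i => z n i * (z n a₁)⁻¹, hy, fun n => mul_inv_cancel _, fun i => ?_, fun i => ?_⟩
  · exact (eq_of_forall_adj_eq (G := G) (h := fun i => z 0 i * (z 0 a₁)⁻¹)
      (fun i j hij => by simpa using hy 0 i j hij) i a₁).trans (mul_inv_cancel _)
  · have h := eq_of_forall_adj_eq (G := G)
      (h := fun i => (PresentedGroup.of i : TriangleGroup G a₁)⁻¹ * (z 1 i * (z 1 a₁)⁻¹))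
      (fun i j hij => by simp [hy 1 i j hij, edgeElt, mul_assoc]) i a₁
    simp only [mul_inv_cancel, of_base_eq_one, inv_one, mul_one] at h
    exact (inv_mul_eq_one.1 h).symm

end EdgeElements

/-! ### The homomorphism to the Artin group -/

section ToRAAG

variable {V : Type*} {G : SimpleGraph V} {a₁ : V}

theorem commute_gen {i j : V} (h : G.Adj i j) : Commute (gen G i) (gen G j) := by
  have hr : PresentedGroup.mk (raagRels G) _ = 1 :=
    PresentedGroup.one_of_mem ⟨i, j, h, rfl⟩
  simp only [map_mul, map_inv] at hr
  change gen G i * gen G j * (gen G i)⁻¹ * (gen G j)⁻¹ = 1 at hr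
  rwa [mul_inv_eq_one, mul_inv_eq_iff_eq_mul] at hr

theorem canonicalEpi_gen (i : V) : canonicalEpi G (gen G i) = Multiplicative.ofAdd 1 :=
  PresentedGroup.toGroup.of _

variable (G a₁) in
/-- The homomorphism sending the generator `x_{0,i}` to `a_i a_1⁻¹`. -/
def toRAAG : TriangleGroup G a₁ →* RAAG G :=
  PresentedGroup.toGroup (f := fun i => gen G i * (gen G a₁)⁻¹) <|
    lift_eq_one_of_mem_bbRels G (mul_inv_cancel _) fun i j k hij hjk hki => by
      have h : Commute (gen G i * (gen G j)⁻¹) (gen G j * (gen G k)⁻¹) :=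
        ((commute_gen hij).mul_right (commute_gen hki.symm).inv_right).mul_left
          ((Commute.refl _).mul_right (commute_gen hjk).inv_right).inv_left
      have h' := inv_mul_eq_one.2 h.symm.eq
      simpa [mul_assoc] using h'

theorem toRAAG_of (i : V) :
    toRAAG G a₁ (PresentedGroup.of i) = gen G i * (gen G a₁)⁻¹ :=
  PresentedGroup.toGroup.of _

theorem toRAAG_mem (p : TriangleGroup G a₁) : toRAAG G a₁ p ∈ bbGroup G := by
  induction p using PresentedGroup.induction_on with | _ w
  have h : ((canonicalEpi G).comp (toRAAG G a₁)) = 1 := PresentedGroup.ext fun i => by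
    simp [toRAAG_of, canonicalEpi_gen]
  exact DFunLike.congr_fun h _

theorem toRAAG_edgeElt (i j : V) :
    toRAAG G a₁ (edgeElt G a₁ i j) = gen G i * (gen G j)⁻¹ := by
  simp [edgeElt, toRAAG_of]

theorem toRAAG_powers [Fintype V] [PreconnectedSpace (flagComplex G)]
    {y : ℤ → V → TriangleGroup G a₁}
    (hy : ∀ n i j, G.Adj i j → y n i = edgeElt G a₁ i j ^ n * y n j) (hy₁ : ∀ n, y n a₁ = 1)
    (n : ℤ) (i : V) : toRAAG G a₁ (y n i) = gen G i ^ n * gen G a₁ ^ (-n) := by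
  have h := eq_of_forall_adj_eq (G := G) (h := fun i => gen G i ^ (-n) * toRAAG G a₁ (y n i))
    (fun i j hij => by
      simp only [hy n i j hij, map_mul, map_zpow, toRAAG_edgeElt,
        (commute_gen hij).inv_right.mul_zpow, zpow_neg, inv_zpow, mul_assoc, inv_mul_cancel_left])
    i a₁
  simp only [hy₁, map_one, mul_one] at h
  rw [← h]
  simp

end ToRAAG

/-! ### The action of the Artin group -/

section Action

variable {V P : Type*} [Group P]

/-- The permutation of `P × ℤ` that describes right multiplication by `a_i` when `(p, m)` stands for
`p * a_1 ^ m` and `y n i` stands for `a_i ^ n * a_1 ^ (-n)`: then `(y m i)⁻¹ * y (m + 1) i` stands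
for `a_1 ^ m * a_i * a_1 ^ (-m - 1)`. -/
def genPerm (y : ℤ → V → P) (i : V) : Equiv.Perm (P × ℤ) where
  toFun z := (z.1 * ((y z.2 i)⁻¹ * y (z.2 + 1) i), z.2 + 1)
  invFun z := (z.1 * ((y (z.2 - 1) i)⁻¹ * y z.2 i)⁻¹, z.2 - 1)
  left_inv z := by simp [mul_assoc]
  right_inv z := by simp [mul_assoc]

theorem genPerm_apply (y : ℤ → V → P) (i : V) (p : P) (m : ℤ) :
    genPerm y i (p, m) = (p * ((y m i)⁻¹ * y (m + 1) i), m + 1) := rfl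

theorem commute_genPerm {y : ℤ → V → P} {i j : V} {e : P} (h : ∀ n, y n i = e ^ n * y n j) :
    Commute (genPerm y i) (genPerm y j) := by
  ext1 ⟨p, m⟩
  simp only [Equiv.Perm.mul_apply, genPerm_apply, h, zpow_add, zpow_one]
  group

variable {G : SimpleGraph V}

/-- The action of the Artin group on `P × ℤ` in which `g` acts as right multiplication by `g⁻¹`. -/
def rightAction (y : ℤ → V → P) (hy : ∀ i j, G.Adj i j → Commute (genPerm y i) (genPerm y j)) :
    RAAG G →* Equiv.Perm (P × ℤ) :=
  PresentedGroup.toGroup (f := fun i => (genPerm y i)⁻¹) <| by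
    rintro _ ⟨i, j, hij, rfl⟩
    simp [(hy i j hij).inv_inv.eq]

theorem rightAction_gen (y : ℤ → V → P)
    (hy : ∀ i j, G.Adj i j → Commute (genPerm y i) (genPerm y j)) (i : V) :
    rightAction y hy (gen G i) = (genPerm y i)⁻¹ :=
  PresentedGroup.toGroup.of _

end Action

/-! ### Bijectivity -/

section Bijectivity

variable {V : Type*} [Fintype V] (G : SimpleGraph V) (a₁ : V)
  [SimplyConnectedSpace (flagComplex G)]

/-- In the action of the Artin group on `P × ℤ`, the element `toRAAG p` moves `(1, 0)` to
`(p⁻¹, 0)`. -/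
theorem toRAAG_injective : Function.Injective (toRAAG G a₁) := by
  obtain ⟨y, hy, -, hy0, hy1⟩ := exists_powers (G := G) (a₁ := a₁)
  let ρ := rightAction (G := G) y fun i j hij => commute_genPerm fun n => hy n i j hij
  have hgen : ∀ i q, genPerm y i (q, 0) = (q * PresentedGroup.of i, 1) := fun i q => by
    simp [genPerm_apply, hy0, hy1]
  let S : Subgroup (TriangleGroup G a₁) :=
    { carrier := {p | ∀ q, ρ (toRAAG G a₁ p) (q, 0) = (q * p⁻¹, 0)}
      one_mem' := fun q => by simp
      mul_mem' := fun {a b} ha hb q => by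
        rw [map_mul, map_mul, Equiv.Perm.mul_apply, hb, ha, mul_inv_rev, mul_assoc]
      inv_mem' := fun {a} ha q => by
        rw [map_inv, map_inv, Equiv.Perm.inv_eq_iff_eq, ha, inv_inv, mul_inv_cancel_right] }
  have hS : ∀ p, p ∈ S := PresentedGroup.generated_by _ S fun i q => by
    rw [toRAAG_of, map_mul, map_inv, rightAction_gen, rightAction_gen, inv_inv,
      Equiv.Perm.mul_apply, hgen, Equiv.Perm.inv_eq_iff_eq, hgen, of_base_eq_one]
    simp
  rw [injective_iff_map_eq_one]
  intro p hp
  have h := hS p 1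
  rw [hp] at h
  simpa using (congrArg Prod.fst h).symm

/-- The map `(p, m) ↦ toRAAG p * a_1 ^ m` is equivariant, hence onto; on the kernel of the canonical
epimorphism the exponent `m` vanishes. -/
theorem exists_toRAAG_eq {g : RAAG G} (hg : g ∈ bbGroup G) : ∃ p, toRAAG G a₁ p = g := by
  obtain ⟨y, hy, hy₁, -, -⟩ := exists_powers (G := G) (a₁ := a₁)
  let ρ := rightAction (G := G) y fun i j hij => commute_genPerm fun n => hy n i j hij
  let F : TriangleGroup G a₁ × ℤ → RAAG G := fun z => toRAAG G a₁ z.1 * gen G a₁ ^ z.2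
  have hF : ∀ i z, F (genPerm y i z) = F z * gen G i := by
    rintro i ⟨p, m⟩
    simp only [F, genPerm_apply, map_mul, map_inv, toRAAG_powers hy hy₁]
    group
  let S : Subgroup (RAAG G) :=
    { carrier := {g | ∀ z, F (ρ g z) = F z * g⁻¹}
      one_mem' := fun z => by simp
      mul_mem' := fun {a b} ha hb z => by
        rw [map_mul, Equiv.Perm.mul_apply, ha, hb, mul_inv_rev, mul_assoc]
      inv_mem' := fun {a} ha z => by
        have h := ha (ρ a⁻¹ z)
        rw [← Equiv.Perm.mul_apply, ← map_mul, mul_inv_cancel, map_one, Equiv.Perm.one_apply] at h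
        rw [h, inv_inv, inv_mul_cancel_right] }
  have hS : ∀ g, g ∈ S := PresentedGroup.generated_by _ S fun i z => by
    change F (ρ (gen G i) z) = F z * (gen G i)⁻¹
    rw [eq_mul_inv_iff_mul_eq, ← hF, rightAction_gen, ← Equiv.Perm.mul_apply, mul_inv_cancel,
      Equiv.Perm.one_apply]
  have h := hS g⁻¹ (1, 0)
  generalize ρ g⁻¹ (1, 0) = z at h
  obtain ⟨p, m⟩ := z
  simp only [F, map_one, zpow_zero, one_mul, inv_inv] at h
  have hdeg := congrArg (canonicalEpi G) h
  rw [map_mul, show canonicalEpi G (toRAAG G a₁ p) = 1 from toRAAG_mem p,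
    show canonicalEpi G g = 1 from hg, map_zpow, canonicalEpi_gen, one_mul, ← ofAdd_zsmul] at hdeg
  obtain rfl : m = 0 := by simpa using hdeg
  exact ⟨p, by simpa using h⟩

/-- The isomorphism from the presented group onto the Bestvina-Brady group. -/
noncomputable def triangleGroupEquiv : TriangleGroup G a₁ ≃* bbGroup G :=
  MulEquiv.ofBijective ((toRAAG G a₁).codRestrict (bbGroup G) toRAAG_mem)
    ⟨fun _ _ h => toRAAG_injective G a₁ (congrArg Subtype.val h), fun g => by
      obtain ⟨p, hp⟩ := exists_toRAAG_eq G a₁ g.2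
      exact ⟨p, Subtype.ext hp⟩⟩

end Bijectivity

end BestvinaBrady

theorem corollary3p11 {V : Type*} [Fintype V] (G : SimpleGraph V) (a₁ : V)
    (hsc : SimplyConnectedSpace (BestvinaBrady.flagComplex G)) :
    BestvinaBrady.tauTriangles G ⊆ Set.range (BestvinaBrady.inclZero V) ∧
    (BestvinaBrady.bbRels G a₁).Finite ∧
    ∃ f : PresentedGroup (BestvinaBrady.bbRels G a₁) ≃* BestvinaBrady.bbGroup G,
      ∀ i : V, (f (PresentedGroup.of i) : BestvinaBrady.RAAG G) =
        BestvinaBrady.gen G i * (BestvinaBrady.gen G a₁)⁻¹ :=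
  ⟨BestvinaBrady.tauTriangles_subset_range G, BestvinaBrady.finite_bbRels G a₁,
    BestvinaBrady.triangleGroupEquiv G a₁, BestvinaBrady.toRAAG_of⟩
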